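/- Let $K$ be a field, $n\ge 0$ an integer, $S=K[x_1,\dots,x_n]$ with its standard $\mathbb Z^n$-grading, and $\mathfrak m=(x_1,\dots,x_n)$. For a finitely generated $\mathbb Z^n$-graded $S$-module $M$, a Stanley decomposition of $M$ is a finite direct sum decomposition of $K$-vector spaces $\mathcal D\colon M=\bigoplus_{i=1}^r m_iK[Z_i]$ in which each $m_i\in M$ is nonzero and homogeneous, $Z_i\subset\{x_1,\dots,x_n\}$, and $m_iK[Z_i]$ is a free $K[Z_i]$-module. Put $\operatorname{sdepth}(\mathcal D)=\min_i|Z_i|$ and let $\operatorname{sdepth}(M)$ be the maximum of $\operatorname{sdepth}(\mathcal D)$ over all Stanley decompositions $\mathcal D$ of $M$. Let $\operatorname{depth}(M)$ be the supremum of the lengths of the $M$-regular sequences contained in $\mathfrak m$. By convention, both numbers are $\infty$ if $M=0$. Theorem 2.6. Let $I\subset S$ be a monomial ideal with at most three minimal monomial generators. Then $I$ and $S/I$ satisfy Stanley's conjecture, that is, $$\operatorname{sdepth}(I)\ge\operatorname{depth}(I)\qquad\text{and}\qquad\operatorname{sdepth}(S/I)\ge\operatorname{depth}(S/I).$$ 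-/

import Mathlib

open MvPolynomial

noncomputable section

namespace Stanley

variable {K : Type*} [Field K] {n : ℕ}

/-- A monomial ideal of `S = K[x_1, …, x_n]`: an ideal generated by a set of monomials. -/
def IsMonomialIdeal (I : Ideal (MvPolynomial (Fin n) K)) : Prop :=
  ∃ A : Set (Fin n →₀ ℕ), I = Ideal.span ((fun a => monomial a (1 : K)) '' A)

/-- The exponent vectors of the minimal monomial generators of a monomial ideal `I`: the monomials
of `I` that are minimal for divisibility (the order on exponent vectors is the coordinatewise
one). -/
def minimalGenerators (I : Ideal (MvPolynomial (Fin n) K)) : Set (Fin n →₀ ℕ) :=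
  {a | Minimal (fun b : Fin n →₀ ℕ => monomial b (1 : K) ∈ I) a}

/-- `g(I)`, the number of minimal monomial generators of `I`. -/
def numGenerators (I : Ideal (MvPolynomial (Fin n) K)) : ℕ∞ :=
  (minimalGenerators I).encard

/-! ### The fine grading, by `ℤ^n` -/

/-- The component of `S` of multidegree `a ∈ ℤ^n`, where `x_i` has degree the `i`-th unit vector:
it is `K · x^a` if all `a i ≥ 0`, and zero otherwise. -/
def multigrading (K : Type*) [Field K] (n : ℕ) (a : Fin n → ℤ) :
    Submodule K (MvPolynomial (Fin n) K) :=
  weightedHomogeneousSubmodule K (fun i : Fin n => (Pi.single i 1 : Fin n → ℤ)) a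

/-- The multigrading of an ideal `I`, as a submodule of `S`: `I_a = I ∩ S_a`. -/
def idealGrading (I : Ideal (MvPolynomial (Fin n) K)) (a : Fin n → ℤ) : Submodule K I :=
  (multigrading K n a).comap ((Submodule.subtype I).restrictScalars K)

/-- The multigrading of `S ⧸ I`: the component `(S ⧸ I)_a` is the image of `S_a`. -/
def quotientGrading (I : Ideal (MvPolynomial (Fin n) K)) (a : Fin n → ℤ) :
    Submodule K (MvPolynomial (Fin n) K ⧸ I) :=
  (multigrading K n a).map (Ideal.Quotient.mkₐ K I).toLinearMap

/-! ### Stanley depth -/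

section Module

variable {M : Type*} [AddCommGroup M] [Module K M] [Module (MvPolynomial (Fin n) K) M]
  [IsScalarTower K (MvPolynomial (Fin n) K) M]

/-- The `K`-subspace `m K[Z]` of `M`, for `m ∈ M` and a set `Z` of variables. -/
def stanleySpace (m : M) (Z : Finset (Fin n)) : Submodule K M :=
  (Subalgebra.toSubmodule (supported K (Z : Set (Fin n)))).map
    ((LinearMap.toSpanSingleton (MvPolynomial (Fin n) K) M m).restrictScalars K)

/-- A Stanley decomposition `M = ⨁ m_i K[Z_i]` (a finite direct sum of `K`-vector spaces) of a
`ℤ^n`-graded `S`-module `M` with components `𝓜 a`: each `m_i` is homogeneous and nonzero, and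
`m_i K[Z_i]` is a free `K[Z_i]`-module, that is, `p ↦ p m_i` is injective on `K[Z_i]`. -/
structure StanleyDecomposition (𝓜 : (Fin n → ℤ) → Submodule K M) where
  /-- the number of summands -/
  r : ℕ
  /-- the generators of the summands -/
  m : Fin r → M
  /-- the sets of variables of the summands -/
  Z : Fin r → Finset (Fin n)
  homogeneous : ∀ i, ∃ a, m i ∈ 𝓜 a
  free : ∀ i, ∀ p ∈ supported K (Z i : Set (Fin n)), p • m i = 0 → p = 0
  isInternal : DirectSum.IsInternal (fun i => (stanleySpace (m i) (Z i) : Submodule K M))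

/-- `sdepth 𝓓 = min_i |Z_i|`; the empty decomposition, which only the zero module has, gets `∞`. -/
def StanleyDecomposition.sdepth {𝓜 : (Fin n → ℤ) → Submodule K M}
    (D : StanleyDecomposition 𝓜) : ℕ∞ :=
  ⨅ i, ((D.Z i).card : ℕ∞)

/-- The Stanley depth of a `ℤ^n`-graded `S`-module with components `𝓜 a`: the largest Stanley depth
of a Stanley decomposition. It is at most `n`, except that the zero module has Stanley
depth `∞`. -/
def sdepth (𝓜 : (Fin n → ℤ) → Submodule K M) : ℕ∞ :=
  ⨆ D : StanleyDecomposition 𝓜, D.sdepth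

end Module

/-! ### Depth -/

open Classical in
/-- The depth of a finitely generated graded `S`-module `M`, with respect to the ideal
`𝔪 = (x_1, …, x_n)`: the supremum of the lengths of the `M`-regular sequences contained in `𝔪`,
with the usual convention that it is `∞` if `𝔪 M = M` (for such an `M`: if `M = 0`). -/
def depth (K : Type*) [Field K] (n : ℕ) (M : Type*) [AddCommGroup M]
    [Module (MvPolynomial (Fin n) K) M] : ℕ∞ :=
  if (idealOfVars (Fin n) K • ⊤ : Submodule (MvPolynomial (Fin n) K) M) = ⊤ then ⊤
  else ⨆ (rs : List (MvPolynomial (Fin n) K)) (_ : RingTheory.Sequence.IsRegular M rs)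
    (_ : ∀ f ∈ rs, f ∈ idealOfVars (Fin n) K), (rs.length : ℕ∞)

end Stanley

end

/-! Both depths are compared with explicit numbers. A partition of the exponent vectors of $I$, or
of their complement, into cylinders of dimension at least $d$ yields a Stanley decomposition, so
sdepth is at least $d$ (`IsMonomialBasis.le_sdepth`). Removing one principal up-set lowers the
dimension bound by at most one (`CylinderPartition.sdiff_Ici`). Hence $k$ generators give
sdepth$(S/I)\ge n-k$, and two or three generators give sdepth$(I)\ge n-1$.

Upper bounds on depth come from a monomial $x^a\notin I$ with $x_ix^a\in I$ for all $i\in Z$. Its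
class in $S/I$ is killed by the variables in $Z$, which forces depth$(S/I)\le n-|Z|$; the same
argument in $I/x_iI$ gives depth$(I)\le n-|Z|+1$. Two distinct minimal generators always provide
such a monomial with $|Z|=2$.

This settles everything except $S/I$ with three generators. If no generator divides the lcm of the
other two, there is a monomial with $|Z|=3$. Otherwise two of the three removals together cost one
dimension, so sdepth$(S/I)\ge n-2$. -/

namespace Stanley

/-! ### Partitions of sets of exponent vectors into cylinders -/

section Cylinder

variable {n : ℕ}

/-- The exponent vectors of the monomials of `x^a K[Z]`. -/
def cylinder (a : Fin n →₀ ℕ) (Z : Finset (Fin n)) : Set (Fin n →₀ ℕ) :=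
  {b | a ≤ b ∧ ∀ j ∉ Z, b j = a j}

/-- `A` is a finite disjoint union of cylinders of dimension at least `d`. -/
inductive CylinderPartition (d : ℕ) : Set (Fin n →₀ ℕ) → Prop
  | empty : CylinderPartition d ∅
  | union (a : Fin n →₀ ℕ) (Z : Finset (Fin n)) (B : Set (Fin n →₀ ℕ)) (hd : d ≤ Z.card)
      (hdisj : Disjoint (cylinder a Z) B) (hB : CylinderPartition d B) :
      CylinderPartition d (cylinder a Z ∪ B)

namespace CylinderPartition

variable {d e : ℕ} {A B : Set (Fin n →₀ ℕ)}

theorem of_cylinder (a : Fin n →₀ ℕ) (Z : Finset (Fin n)) (hd : d ≤ Z.card) :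
    CylinderPartition d (cylinder a Z) := by
  simpa using union a Z ∅ hd (by simp) empty

theorem mono (h : CylinderPartition d A) (hed : e ≤ d) : CylinderPartition e A := by
  induction h with
  | empty => exact empty
  | union a Z B hd hdisj _ ih => exact union a Z B (hed.trans hd) hdisj ih

theorem disjoint_union (hA : CylinderPartition d A) (hB : CylinderPartition d B)
    (h : Disjoint A B) : CylinderPartition d (A ∪ B) := by
  induction hA with
  | empty => simpa using hB
  | union a Z A hd hdisj _ ih =>
    rw [Set.disjoint_union_left] at h
    rw [Set.union_assoc]
    exact union a Z _ hd (Set.disjoint_union_right.2 ⟨hdisj, h.1⟩) (ih h.2)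

/-- Induction on the total deficit of `a` below `u`. If `a j < u j` with `j ∈ Z`, the slice `b j = a
j` misses the up-set and is a cylinder of one dimension less; the rest is the cylinder based at `a +
e_j`. If `j ∉ Z`, the whole cylinder misses the up-set. -/
theorem cylinder_sdiff_Ici (a u : Fin n →₀ ℕ) (Z : Finset (Fin n)) :
    CylinderPartition (Z.card - 1) (cylinder a Z \ Set.Ici u) := by
  induction hk : ∑ j, (u j - a j) using Nat.strong_induction_on generalizing a with
  | _ k ih =>
  by_cases hua : u ≤ a
  · convert empty (n := n) using 1
    ext b
    simp only [cylinder, Set.mem_sdiff, Set.mem_ofPred_eq, Set.mem_Ici, Set.mem_empty_iff_false,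
      iff_false, not_and, not_not]
    exact fun hb => hua.trans hb.1
  · obtain ⟨j, hj⟩ : ∃ j, a j < u j := by
      by_contra! hcon
      exact hua hcon
    by_cases hjZ : j ∈ Z
    · have hlt : ∑ i, (u i - (a + Finsupp.single j 1 : Fin n →₀ ℕ) i) < k := by
        rw [← hk]
        refine Finset.sum_lt_sum (fun i _ => ?_) ⟨j, Finset.mem_univ _, ?_⟩
        · simp only [Finsupp.add_apply]; omega
        · simp only [Finsupp.add_apply, Finsupp.single_eq_same]; omega
      have h := (of_cylinder (d := Z.card - 1) a (Z.erase j)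
        (by rw [Finset.card_erase_of_mem hjZ])).disjoint_union (ih _ hlt _ rfl) (by
          rw [Set.disjoint_left]
          rintro b hb ⟨hb', -⟩
          have h1 := hb.2 j (by simp)
          have h2 := hb'.1 j
          simp at h2
          omega)
      convert h using 1
      ext b
      simp only [cylinder, Set.mem_sdiff, Set.mem_ofPred_eq, Set.mem_Ici, Set.mem_union]
      constructor
      · rintro ⟨⟨h1, h2⟩, h3⟩
        by_cases hbj : b j = a j
        · left
          refine ⟨h1, fun i hi => ?_⟩
          by_cases hij : i = j
          · rw [hij, hbj]
          · exact h2 i (by simpa [hij] using hi)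
        · right
          have h4 := h1 j
          refine ⟨⟨fun i => ?_, fun i hi => ?_⟩, h3⟩
          · by_cases hij : i = j
            · subst hij; simp; omega
            · simpa [Finsupp.single_apply, Ne.symm hij] using h1 i
          · have hij : j ≠ i := fun h => hi (h ▸ hjZ)
            simpa [Finsupp.single_apply, hij] using h2 i hi
      · rintro (⟨h1, h2⟩ | ⟨⟨h1, h2⟩, h3⟩)
        · refine ⟨⟨h1, fun i hi => h2 i (by simp [hi])⟩, fun h3 => ?_⟩
          have := h3 j
          have := h2 j (by simp)
          omega
        · refine ⟨⟨le_trans (by simp) h1, fun i hi => ?_⟩, h3⟩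
          have hij : j ≠ i := fun h => hi (h ▸ hjZ)
          simpa [Finsupp.single_apply, hij] using h2 i hi
    · convert of_cylinder (d := Z.card - 1) a Z (by omega) using 1
      rw [sdiff_eq_left, Set.disjoint_left]
      intro b hb hub
      have := hb.2 j hjZ
      have := hub j
      omega

theorem sdiff_Ici (h : CylinderPartition d A) (u : Fin n →₀ ℕ) :
    CylinderPartition (d - 1) (A \ Set.Ici u) := by
  induction h with
  | empty => simpa using empty
  | union a Z B hd hdisj _ ih =>
    rw [Set.union_sdiff_distrib]
    exact ((cylinder_sdiff_Ici a u Z).mono (by omega)).disjoint_union ih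
      (hdisj.mono Set.sdiff_subset Set.sdiff_subset)

/-- Removing two principal up-sets costs only one dimension if they are disjoint inside `A`. -/
theorem sdiff_Ici_sdiff_Ici (h : CylinderPartition d A) (u v : Fin n →₀ ℕ)
    (huv : A ∩ Set.Ici (u ⊔ v) = ∅) :
    CylinderPartition (d - 1) ((A \ Set.Ici u) \ Set.Ici v) := by
  induction h with
  | empty => simpa using empty
  | union a Z B hd hdisj _ ih =>
    rw [Set.union_inter_distrib_right, Set.union_empty_iff] at huv
    rw [Set.union_sdiff_distrib, Set.union_sdiff_distrib]
    refine disjoint_union ?_ (ih huv.2)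
      (hdisj.mono (Set.sdiff_subset.trans Set.sdiff_subset)
        (Set.sdiff_subset.trans Set.sdiff_subset))
    by_cases hu : Disjoint (cylinder a Z) (Set.Ici u)
    · rw [sdiff_eq_left.2 hu]
      exact (cylinder_sdiff_Ici a v Z).mono (by omega)
    · by_cases hv : Disjoint (cylinder a Z) (Set.Ici v)
      · rw [sdiff_eq_left.2 (hv.mono_left Set.sdiff_subset)]
        exact (cylinder_sdiff_Ici a u Z).mono (by omega)
      · exfalso
        obtain ⟨p, hp, hpu⟩ := Set.not_disjoint_iff.1 hu
        obtain ⟨q, hq, hqv⟩ := Set.not_disjoint_iff.1 hv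
        -- Cylinders are closed under joins, so one meeting both up-sets would meet their
        -- intersection.
        have : p ⊔ q ∈ cylinder a Z ∩ Set.Ici (u ⊔ v) := by
          refine ⟨⟨hp.1.trans le_sup_left, fun j hj => ?_⟩, Set.mem_Ici.2 (sup_le_sup hpu hqv)⟩
          rw [Finsupp.sup_apply, hp.2 j hj, hq.2 j hj, sup_idem]
        rw [huv.1] at this
        exact this

theorem cylinder_univ (a : Fin n →₀ ℕ) : cylinder a Finset.univ = Set.Ici a := by
  ext b; simp [cylinder]

theorem Ici (a : Fin n →₀ ℕ) : CylinderPartition n (Set.Ici a) := by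
  rw [← cylinder_univ]
  exact of_cylinder _ _ (by simp)

theorem univ : CylinderPartition n (Set.univ : Set (Fin n →₀ ℕ)) := by
  rw [← Set.Ici_bot]
  exact Ici _

theorem Ici_union_Ici (u v : Fin n →₀ ℕ) :
    CylinderPartition (n - 1) (Set.Ici u ∪ Set.Ici v) := by
  rw [← Set.union_sdiff_self]
  exact ((Ici u).mono (by omega)).disjoint_union ((Ici v).sdiff_Ici u) Set.disjoint_sdiff_right

/-- The cyclic differences `u \ w`, `v \ u`, `w \ v` are disjoint and cover everything but the
triple intersection: a proper nonempty subset of a 3-cycle is an arc, with exactly one starting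
point. Each difference removes only one up-set. -/
theorem Ici_union_Ici_union_Ici (u v w : Fin n →₀ ℕ) :
    CylinderPartition (n - 1) (Set.Ici u ∪ Set.Ici v ∪ Set.Ici w) := by
  have h := ((((Ici u).sdiff_Ici w).disjoint_union ((Ici v).sdiff_Ici u) ?_).disjoint_union
    ((Ici w).sdiff_Ici v) ?_).disjoint_union ((Ici (u ⊔ v ⊔ w)).mono (Nat.sub_le n 1)) ?_
  · convert h using 1
    ext b
    simp only [Set.mem_union, Set.mem_sdiff, Set.mem_Ici, sup_le_iff]
    tauto
  all_goals
    rw [Set.disjoint_left]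
    intro b
    simp only [Set.mem_union, Set.mem_sdiff, Set.mem_Ici, sup_le_iff]
    tauto

theorem exists_list (h : CylinderPartition d A) :
    ∃ L : List ((Fin n →₀ ℕ) × Finset (Fin n)),
      L.Pairwise (fun p q => Disjoint (cylinder p.1 p.2) (cylinder q.1 q.2)) ∧
      (∀ p ∈ L, d ≤ p.2.card) ∧ ∀ b, b ∈ A ↔ ∃ p ∈ L, b ∈ cylinder p.1 p.2 := by
  induction h with
  | empty => exact ⟨[], by simp⟩
  | union a Z B hd hdisj _ ih =>
    obtain ⟨L, h1, h2, h3⟩ := ih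
    refine ⟨(a, Z) :: L, ?_, ?_, ?_⟩
    · refine List.pairwise_cons.2 ⟨fun p hp => hdisj.mono_right fun b hb => ?_, h1⟩
      exact (h3 b).2 ⟨p, hp, hb⟩
    · simpa [hd] using h2
    · intro b
      rw [Set.mem_union, h3]
      simp

theorem exists_family (h : CylinderPartition d A) :
    ∃ (r : ℕ) (a : Fin r → Fin n →₀ ℕ) (Z : Fin r → Finset (Fin n)),
      Pairwise (Function.onFun Disjoint fun i => cylinder (a i) (Z i)) ∧
      (∀ i, d ≤ (Z i).card) ∧ ⋃ i, cylinder (a i) (Z i) = A := by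
  obtain ⟨L, h1, h2, h3⟩ := h.exists_list
  refine ⟨L.length, fun i => (L.get i).1, fun i => (L.get i).2, ?_, fun i => h2 _ (L.get_mem i), ?_⟩
  · rw [List.pairwise_iff_get] at h1
    intro i j hij
    rcases lt_or_gt_of_ne hij with hlt | hlt
    · exact h1 i j hlt
    · exact (h1 j i hlt).symm
  · ext b
    rw [h3, Set.mem_iUnion]
    constructor
    · rintro ⟨i, hi⟩
      exact ⟨_, L.get_mem i, hi⟩
    · rintro ⟨p, hp, hb⟩
      obtain ⟨i, rfl⟩ := List.get_of_mem hp
      exact ⟨i, hb⟩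

end CylinderPartition

end Cylinder

/-! ### From cylinder partitions to Stanley decompositions -/

section Decomposition

variable {K : Type*} [Field K] {n : ℕ}

theorem support_subset_of_mem_supported {p : MvPolynomial (Fin n) K} {Z : Finset (Fin n)}
    (hp : p ∈ supported K (Z : Set (Fin n))) {c : Fin n →₀ ℕ} (hc : c ∈ p.support) {j : Fin n}
    (hj : j ∉ Z) : c j = 0 := by
  by_contra h
  exact hj (mem_supported.1 hp ((mem_vars_iff_mem_support j).2 ⟨c, hc, Finsupp.mem_support_iff.2 h⟩))

theorem monomial_mem_supported {Z : Finset (Fin n)} {c : Fin n →₀ ℕ} (hc : ∀ j ∉ Z, c j = 0) :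
    monomial c (1 : K) ∈ supported K (Z : Set (Fin n)) := by
  rw [mem_supported]
  intro j hj
  obtain ⟨d, hd, hjd⟩ := (mem_vars_iff_mem_support j).1 hj
  replace hd := Finset.mem_singleton.1 (support_monomial_subset hd)
  subst hd
  by_contra h
  exact Finsupp.mem_support_iff.1 hjd (hc j h)

theorem add_mem_cylinder {a c : Fin n →₀ ℕ} {Z : Finset (Fin n)} (hc : ∀ j ∉ Z, c j = 0) :
    a + c ∈ cylinder a Z :=
  ⟨by simp, fun j hj => by simp [hc j hj]⟩

section Module

variable {M : Type*} [AddCommGroup M] [Module K M] [Module (MvPolynomial (Fin n) K) M]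
  [IsScalarTower K (MvPolynomial (Fin n) K) M]

/-- A `K`-basis of `M`, indexed by a set `A` of exponent vectors, on which the monomials act by
translation as long as the result remains in `A`. -/
structure IsMonomialBasis (b : (Fin n →₀ ℕ) → M) (A : Set (Fin n →₀ ℕ)) : Prop where
  linearIndepOn : LinearIndepOn K b A
  span_eq_top : Submodule.span K (b '' A) = ⊤
  smul_eq : ∀ a ∈ A, ∀ c, a + c ∈ A → monomial c (1 : K) • b a = b (a + c)

namespace IsMonomialBasis

variable {b : (Fin n →₀ ℕ) → M} {A : Set (Fin n →₀ ℕ)}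

theorem smul_eq_sum (h : IsMonomialBasis (K := K) b A) {a : Fin n →₀ ℕ} {Z : Finset (Fin n)}
    (hA : cylinder a Z ⊆ A) {p : MvPolynomial (Fin n) K}
    (hp : p ∈ supported K (Z : Set (Fin n))) :
    p • b a = ∑ c ∈ p.support, coeff c p • b (a + c) := by
  conv_lhs => rw [← support_sum_monomial_coeff p, Finset.sum_smul]
  refine Finset.sum_congr rfl fun c hc => ?_
  rw [← h.smul_eq a (hA ⟨le_rfl, fun _ _ => rfl⟩) c
    (hA (add_mem_cylinder fun j hj => support_subset_of_mem_supported hp hc hj)), ← smul_assoc,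
    smul_monomial, smul_eq_mul, mul_one]

theorem stanleySpace_eq (h : IsMonomialBasis (K := K) b A) {a : Fin n →₀ ℕ}
    {Z : Finset (Fin n)} (hA : cylinder a Z ⊆ A) :
    (stanleySpace (b a) Z : Submodule K M) = Submodule.span K (b '' cylinder a Z) := by
  apply le_antisymm
  · rintro _ ⟨p, hp, rfl⟩
    have hp' : p ∈ supported K (Z : Set (Fin n)) := hp
    change p • b a ∈ _
    rw [h.smul_eq_sum hA hp']
    refine Submodule.sum_mem _ fun c hc => Submodule.smul_mem _ _ (Submodule.subset_span ⟨_, ?_, rfl⟩)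
    exact add_mem_cylinder fun j hj => support_subset_of_mem_supported hp' hc hj
  · rw [Submodule.span_le]
    rintro _ ⟨c, hc, rfl⟩
    obtain ⟨e, rfl⟩ := exists_add_of_le hc.1
    refine ⟨monomial e 1, monomial_mem_supported fun j hj => ?_, ?_⟩
    · simpa using hc.2 j hj
    · exact h.smul_eq a (hA ⟨le_rfl, fun _ _ => rfl⟩) e (hA hc)

theorem eq_zero_of_smul_eq_zero (h : IsMonomialBasis (K := K) b A) {a : Fin n →₀ ℕ}
    {Z : Finset (Fin n)} (hA : cylinder a Z ⊆ A) {p : MvPolynomial (Fin n) K}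
    (hp : p ∈ supported K (Z : Set (Fin n))) (h0 : p • b a = 0) : p = 0 := by
  rw [h.smul_eq_sum hA hp] at h0
  have hli : LinearIndependent K (fun c : p.support => b (a + c)) := by
    refine h.linearIndepOn.linearIndependent.comp
      (fun c : p.support => (⟨a + c, hA (add_mem_cylinder fun j hj =>
        support_subset_of_mem_supported hp c.2 hj)⟩ : A)) ?_
    intro c d hcd
    exact Subtype.ext (add_left_cancel (congrArg Subtype.val hcd))
  rw [← Finset.sum_coe_sort] at h0
  have hz := Fintype.linearIndependent_iff.1 hli (fun c => coeff c p) h0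
  ext c
  by_cases hc : c ∈ p.support
  · simpa using hz ⟨c, hc⟩
  · simpa using notMem_support_iff.1 hc

theorem le_sdepth (h : IsMonomialBasis (K := K) b A) {𝓜 : (Fin n → ℤ) → Submodule K M}
    (hom : ∀ a ∈ A, ∃ c, b a ∈ 𝓜 c) {d : ℕ} (hA : CylinderPartition d A) :
    (d : ℕ∞) ≤ sdepth 𝓜 := by
  obtain ⟨r, a, Z, hdisj, hd, hU⟩ := hA.exists_family
  have hsub : ∀ i, cylinder (a i) (Z i) ⊆ A := fun i =>
    hU ▸ Set.subset_iUnion (fun i => cylinder (a i) (Z i)) i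
  have hself : ∀ i, a i ∈ A := fun i => hsub i ⟨le_rfl, fun _ _ => rfl⟩
  let D : StanleyDecomposition 𝓜 :=
    { r := r
      m := fun i => b (a i)
      Z := Z
      homogeneous := fun i => hom _ (hself i)
      free := fun i p hp h0 => h.eq_zero_of_smul_eq_zero (hsub i) hp h0
      isInternal := by
        apply DirectSum.isInternal_submodule_of_iSupIndep_of_iSup_eq_top
        · rw [iSupIndep_def]
          intro i
          simp only [h.stanleySpace_eq (hsub _), ← Submodule.span_iUnion, ← Set.image_iUnion]
          have hs : ∀ s ⊆ A, b '' s = (fun x : A => b x) '' (Subtype.val ⁻¹' s) := by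
            intro s hs
            change _ = (b ∘ Subtype.val) '' _
            rw [Set.image_comp, Subtype.image_preimage_coe, Set.inter_eq_self_of_subset_right hs]
          rw [hs _ (hsub i), hs _ (Set.iUnion_subset fun j => Set.iUnion_subset fun _ => hsub j)]
          refine h.linearIndepOn.linearIndependent.disjoint_span_image (Disjoint.preimage _ ?_)
          simp only [Set.disjoint_iUnion_right]
          exact fun j hj => hdisj hj.symm
        · simp only [h.stanleySpace_eq (hsub _), ← Submodule.span_iUnion, ← Set.image_iUnion]
          rw [hU, h.span_eq_top] }
  refine le_trans ?_ (le_iSup (fun D : StanleyDecomposition 𝓜 => D.sdepth) D)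
  exact le_iInf fun i => Nat.cast_le.2 (hd i)

/-- The empty partition satisfies every dimension bound `d`. -/
theorem sdepth_eq_top (h : IsMonomialBasis (K := K) b (∅ : Set (Fin n →₀ ℕ)))
    {𝓜 : (Fin n → ℤ) → Submodule K M} : sdepth 𝓜 = ⊤ :=
  ENat.eq_top_iff_forall_ge.2 fun _ => h.le_sdepth (by simp) CylinderPartition.empty

end IsMonomialBasis

end Module

/-- The exponent vectors of the monomials of `I`. -/
def exponents (I : Ideal (MvPolynomial (Fin n) K)) : Set (Fin n →₀ ℕ) :=
  {a | monomial a (1 : K) ∈ I}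

variable {I : Ideal (MvPolynomial (Fin n) K)}

theorem mem_exponents {a : Fin n →₀ ℕ} : a ∈ exponents I ↔ monomial a (1 : K) ∈ I := Iff.rfl

theorem isUpperSet_exponents : IsUpperSet (exponents I) := by
  intro a b hab ha
  obtain ⟨c, rfl⟩ := exists_add_of_le hab
  have := I.mul_mem_right (monomial c 1) (mem_exponents.1 ha)
  rwa [monomial_mul, one_mul] at this

theorem IsMonomialIdeal.mem_iff (hI : IsMonomialIdeal I) {p : MvPolynomial (Fin n) K} :
    p ∈ I ↔ ∀ c ∈ p.support, c ∈ exponents I := by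
  constructor
  · obtain ⟨A, rfl⟩ := hI
    intro hp c hc
    rw [mem_ideal_span_monomial_image] at hp
    rw [mem_exponents, mem_ideal_span_monomial_image]
    intro d hd
    replace hd := Finset.mem_singleton.1 (support_monomial_subset hd)
    exact hd ▸ hp c hc
  · intro h
    rw [← support_sum_monomial_coeff p]
    refine Ideal.sum_mem _ fun c hc => ?_
    have := I.mul_mem_left (C (coeff c p)) (mem_exponents.1 (h c hc))
    rwa [C_mul_monomial, mul_one] at this

theorem monomial_mem_multigrading (a : Fin n →₀ ℕ) :
    monomial a (1 : K) ∈ multigrading K n (fun i => (a i : ℤ)) := by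
  rw [multigrading, mem_weightedHomogeneousSubmodule]
  refine isWeightedHomogeneous_monomial _ _ _ ?_
  rw [Finsupp.weight_apply, Finsupp.sum_fintype _ _ (by simp)]
  ext j
  simp [Finset.sum_apply, Pi.single_apply]

open Classical in
/-- The monomial with exponent vector `a` as an element of `I`, and `0` if it is not in `I`. -/
noncomputable def idealMonomial (I : Ideal (MvPolynomial (Fin n) K)) (a : Fin n →₀ ℕ) : I :=
  if h : monomial a (1 : K) ∈ I then ⟨monomial a 1, h⟩ else 0

theorem coe_idealMonomial {a : Fin n →₀ ℕ} (ha : a ∈ exponents I) :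
    (idealMonomial I a : MvPolynomial (Fin n) K) = monomial a 1 := by
  rw [idealMonomial, dif_pos (mem_exponents.1 ha)]

theorem linearIndependent_monomial :
    LinearIndependent K (fun a : Fin n →₀ ℕ => monomial a (1 : K)) := by
  simpa using (basisMonomials (Fin n) K).linearIndependent

theorem IsMonomialIdeal.isMonomialBasis_ideal (hI : IsMonomialIdeal I) :
    IsMonomialBasis (K := K) (idealMonomial I) (exponents I) where
  linearIndepOn := by
    refine LinearIndependent.of_comp ((Submodule.subtype I).restrictScalars K) ?_
    have h := linearIndependent_monomial (K := K) (n := n).comp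
      (Subtype.val : exponents I → _) Subtype.val_injective
    have heq : (Submodule.subtype I).restrictScalars K ∘ (fun a : exponents I => idealMonomial I a) =
        (fun a => monomial a (1 : K)) ∘ Subtype.val := funext fun a => coe_idealMonomial a.2
    exact heq ▸ h
  span_eq_top := by
    rw [eq_top_iff]
    rintro ⟨p, hp⟩ -
    have : (⟨p, hp⟩ : I) = ∑ c ∈ p.support, coeff c p • idealMonomial I c := by
      apply Subtype.ext
      rw [AddSubmonoidClass.coe_finsetSum]
      refine (support_sum_monomial_coeff p).symm.trans (Finset.sum_congr rfl fun c hc => ?_)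
      change _ = coeff c p • (idealMonomial I c : MvPolynomial (Fin n) K)
      rw [coe_idealMonomial (hI.mem_iff.1 hp c hc), smul_monomial, smul_eq_mul, mul_one]
    rw [this]
    exact Submodule.sum_mem _ fun c hc => Submodule.smul_mem _ _
      (Submodule.subset_span ⟨c, hI.mem_iff.1 hp c hc, rfl⟩)
  smul_eq a ha c hac := by
    apply Subtype.ext
    change monomial c (1 : K) * (idealMonomial I a : MvPolynomial (Fin n) K) = _
    rw [coe_idealMonomial ha, coe_idealMonomial hac, monomial_mul, one_mul, add_comm]

theorem IsMonomialIdeal.isMonomialBasis_quotient (hI : IsMonomialIdeal I) :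
    IsMonomialBasis (K := K) (fun a => Ideal.Quotient.mk I (monomial a (1 : K)))
      (exponents I)ᶜ where
  linearIndepOn := by
    have h := linearIndependent_monomial (K := K) (n := n).comp
      (Subtype.val : ((exponents I)ᶜ : Set _) → _) Subtype.val_injective
    refine h.map (f := (Ideal.Quotient.mkₐ K I).toLinearMap) ?_
    rw [Submodule.disjoint_def]
    intro p hp hp0
    have hpI : p ∈ I := Ideal.Quotient.eq_zero_iff_mem.1 hp0
    have hp' : ∀ c ∈ p.support, c ∈ (exponents I)ᶜ := by
      have : p ∈ restrictSupport K (exponents I)ᶜ := by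
        refine (Submodule.span_le.2 ?_) hp
        rintro _ ⟨c, rfl⟩
        rw [SetLike.mem_coe, mem_restrictSupport_iff]
        intro d hd
        simp only [Function.comp_apply, Finset.mem_coe] at hd
        replace hd := Finset.mem_singleton.1 (support_monomial_subset hd)
        exact hd ▸ c.2
      exact fun c hc => (mem_restrictSupport_iff _).1 this hc
    rw [← support_eq_empty, Finset.eq_empty_iff_forall_notMem]
    exact fun c hc => hp' c hc (hI.mem_iff.1 hpI c hc)
  span_eq_top := by
    rw [eq_top_iff]
    intro q _
    obtain ⟨p, rfl⟩ := Ideal.Quotient.mk_surjective q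
    rw [← support_sum_monomial_coeff p, map_sum]
    refine Submodule.sum_mem _ fun c _ => ?_
    have : Ideal.Quotient.mk I (monomial c (coeff c p)) =
        coeff c p • Ideal.Quotient.mk I (monomial c 1) := by
      rw [← Ideal.Quotient.mkₐ_eq_mk K, ← map_smul, smul_monomial, smul_eq_mul, mul_one]
    rw [this]
    refine Submodule.smul_mem _ _ ?_
    by_cases hc : c ∈ exponents I
    · rw [Ideal.Quotient.eq_zero_iff_mem.2 (mem_exponents.1 hc)]
      exact zero_mem _
    · exact Submodule.subset_span ⟨c, hc, rfl⟩
  smul_eq a _ c _ := by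
    change Ideal.Quotient.mk I (monomial c 1 * monomial a 1) = _
    rw [monomial_mul, one_mul, add_comm]

theorem exists_idealMonomial_mem_idealGrading {a : Fin n →₀ ℕ} (ha : a ∈ exponents I) :
    ∃ c, idealMonomial I a ∈ idealGrading I c := by
  refine ⟨fun i => a i, ?_⟩
  change (idealMonomial I a : MvPolynomial (Fin n) K) ∈ multigrading K n _
  rw [coe_idealMonomial ha]
  exact monomial_mem_multigrading a

theorem exists_mk_monomial_mem_quotientGrading (a : Fin n →₀ ℕ) :
    ∃ c, Ideal.Quotient.mk I (monomial a (1 : K)) ∈ quotientGrading I c :=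
  ⟨fun i => a i, monomial a 1, monomial_mem_multigrading a, rfl⟩

theorem IsMonomialIdeal.le_sdepth_ideal (hI : IsMonomialIdeal I) {d : ℕ}
    (h : CylinderPartition d (exponents I)) : (d : ℕ∞) ≤ sdepth (idealGrading I) :=
  hI.isMonomialBasis_ideal.le_sdepth (fun _ ha => exists_idealMonomial_mem_idealGrading ha) h

theorem IsMonomialIdeal.le_sdepth_quotient (hI : IsMonomialIdeal I) {d : ℕ}
    (h : CylinderPartition d (exponents I)ᶜ) : (d : ℕ∞) ≤ sdepth (quotientGrading I) :=
  hI.isMonomialBasis_quotient.le_sdepth (fun a _ => exists_mk_monomial_mem_quotientGrading a) h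

theorem IsMonomialIdeal.sdepth_ideal_eq_top (hI : IsMonomialIdeal I) (h : exponents I = ∅) :
    sdepth (idealGrading I) = ⊤ :=
  (h ▸ hI.isMonomialBasis_ideal).sdepth_eq_top

theorem IsMonomialIdeal.sdepth_quotient_eq_top (hI : IsMonomialIdeal I)
    (h : (exponents I)ᶜ = ∅) : sdepth (quotientGrading I) = ⊤ :=
  (h ▸ hI.isMonomialBasis_quotient).sdepth_eq_top

end Decomposition

/-! ### Regular sequences, associated primes and `Ext` -/

section Local

open RingTheory.Sequence Pointwise

universe u

/-- Over a Noetherian local ring, the length of an `M`-regular sequence is at most the dimension of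
any associated prime of `M`. -/
theorem length_le_ringKrullDim_of_isAssociatedPrime {R : Type*} [CommRing R] [IsLocalRing R]
    [IsNoetherianRing R] (rs : List R) {M : Type*} [AddCommGroup M] [Module R M]
    [Module.Finite R M] (reg : IsWeaklyRegular M rs)
    (mem : ∀ r ∈ rs, r ∈ IsLocalRing.maximalIdeal R) {P : Ideal R} (hP : IsAssociatedPrime P M) :
    (rs.length : WithBot ℕ∞) ≤ ringKrullDim (R ⧸ P) := by
  induction rs generalizing M P with
  | nil =>
    have := Ideal.Quotient.nontrivial_iff.2 hP.isPrime.ne_top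
    simpa using ringKrullDim_nonneg_of_nontrivial
  | cons f rs ih =>
    rw [isWeaklyRegular_cons_iff] at reg
    obtain ⟨hf, reg⟩ := reg
    rw [List.forall_mem_cons] at mem
    obtain ⟨hfm, mem⟩ := mem
    obtain ⟨hprime, x, hx⟩ := isAssociatedPrime_iff.1 hP
    have hxmem : ∀ p, p ∈ P ↔ p • x = 0 := fun p => by
      rw [hx, Submodule.mem_colon_singleton, Submodule.mem_bot]
    have hx0 : x ≠ 0 := by
      rintro rfl
      exact hprime.ne_top (P.eq_top_iff_one.2 ((hxmem 1).2 (smul_zero _)))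
    have hfP : f ∉ P := fun h => hx0 (hf.right_eq_zero_of_smul ((hxmem f).1 h))
    -- Otherwise the submodule `N` killed by `P` lies in `f • M`, hence in `f • N` because `f` is
    -- regular; Nakayama then gives `N = 0`, although `x ∈ N`.
    obtain ⟨y, hyP, hy⟩ : ∃ y : M, (∀ p ∈ P, p • y = 0) ∧ y ∉ f • (⊤ : Submodule R M) := by
      by_contra! hcon
      have hbot : Submodule.torsionBySet R M (P : Set R) = ⊥ := by
        refine Submodule.eq_bot_of_le_smul_of_le_jacobson_bot (Ideal.span {f}) _
          (IsNoetherian.noetherian _) ?_ ?_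
        · intro y hy
          rw [Submodule.mem_torsionBySet_iff] at hy
          obtain ⟨z, -, rfl⟩ := hcon y fun p hp => hy ⟨p, hp⟩
          refine Submodule.smul_mem_smul (Ideal.mem_span_singleton_self f) ?_
          rw [Submodule.mem_torsionBySet_iff]
          intro p
          refine hf.right_eq_zero_of_smul ?_
          rw [smul_comm]
          exact hy p
        · rw [Ideal.span_singleton_le_iff_mem]
          exact IsLocalRing.maximalIdeal_le_jacobson _ hfm
      refine hx0 ((Submodule.mem_bot R).1 (hbot ▸ ?_))
      rw [Submodule.mem_torsionBySet_iff]
      exact fun p => (hxmem p).1 p.2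
    have hy' : (Submodule.Quotient.mk y : QuotSMulTop f M) ≠ 0 := by
      rwa [Ne, Submodule.Quotient.mk_eq_zero]
    -- `Q` contains `P` and `f`, while `f ∉ P`, so the dimension drops from `R ⧸ P` to `R ⧸ Q`.
    obtain ⟨Q, hQ, hle⟩ := exists_le_isAssociatedPrime_of_isNoetherianRing R _ hy'
    have hPQ : P ≤ Q := fun p hp => hle <| by
      rw [Submodule.mem_colon_singleton, Submodule.mem_bot, ← Submodule.Quotient.mk_smul, hyP p hp,
        Submodule.Quotient.mk_zero]
    have hfQ : f ∈ Q := hle <| by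
      rw [Submodule.mem_colon_singleton, Submodule.mem_bot, ← Submodule.Quotient.mk_smul,
        Submodule.Quotient.mk_eq_zero]
      exact Submodule.smul_mem_pointwise_smul _ _ _ trivial
    have hdim := ringKrullDim_succ_le_of_surjective (Ideal.Quotient.factor hPQ)
      (Ideal.Quotient.factor_surjective hPQ) (r := Ideal.Quotient.mk P f)
      (mem_nonZeroDivisors_of_ne_zero (by rwa [Ne, Ideal.Quotient.eq_zero_iff_mem]))
      (by rwa [Ideal.Quotient.factor_mk, Ideal.Quotient.eq_zero_iff_mem])
    refine le_trans ?_ hdim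
    rw [List.length_cons, Nat.cast_succ]
    gcongr
    exact ih reg mem hQ

theorem smul_top_quotSMulTop_ne_top {R M : Type*} [CommRing R] [AddCommGroup M]
    [Module R M] {I : Ideal R} {r : R} (hr : r ∈ I)
    (hI : I • (⊤ : Submodule R M) ≠ ⊤) :
    I • (⊤ : Submodule R (QuotSMulTop r M)) ≠ ⊤ := by
  by_contra eq
  absurd congrArg (Submodule.comap (Submodule.mkQ _)) eq
  simpa [Submodule.comap_smul_top_of_surjective I _ (Submodule.mkQ_surjective _),
    Submodule.smul_mono_left ((Ideal.span_singleton_le_iff_mem I).mpr hr),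
    ← Submodule.ideal_span_singleton_smul] using hI

open CategoryTheory Abelian in
/-- If `I` contains an `M`-regular sequence of length `k + 1` and `x ∈ I` is `M`-regular, then `I`
contains an `M / xM`-regular sequence of length `k`. -/
theorem exists_isRegular_quotSMulTop {R : Type u} [CommRing R] [IsNoetherianRing R] {I : Ideal R}
    {M : Type u} [AddCommGroup M] [Module R M] [Module.Finite R M]
    (hI : I • (⊤ : Submodule R M) ≠ ⊤) {rs : List R} (reg : IsRegular M rs)
    (mem : ∀ r ∈ rs, r ∈ I) {k : ℕ} (hk : rs.length = k + 1) {x : R} (hx : x ∈ I)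
    (hxreg : IsSMulRegular M x) :
    ∃ rs' : List R, rs'.length = k ∧ (∀ r ∈ rs', r ∈ I) ∧ IsRegular (QuotSMulTop x M) rs' := by
  -- Rees: regular sequences of a given length in `I` exist exactly when `Ext` into the module
  -- vanishes below that degree. In the long exact sequence of multiplication by `x`, degree `i` for
  -- `M / xM` sits between degrees `i` and `i + 1` for `M`.
  have rees := (ModuleCat.exists_isRegular_tfae I (k + 1) (ModuleCat.of R M) hI.lt_top).out 3 1
  have h_ext := rees.1 ⟨rs, hk, mem, reg⟩
  refine ((ModuleCat.exists_isRegular_tfae I k (ModuleCat.of R (QuotSMulTop x M))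
    (smul_top_quotSMulTop_ne_top hx hI).lt_top).out 1 3).1 ?_
  intro i hi
  have zero1 := AddCommGrpCat.isZero_of_iff_subsingleton.mpr (h_ext i (by omega))
  have zero2 := AddCommGrpCat.isZero_of_iff_subsingleton.mpr (h_ext (i + 1) (by omega))
  have hxreg' : IsSMulRegular (ModuleCat.of R M) x := hxreg
  exact AddCommGrpCat.subsingleton_of_isZero <| ShortComplex.Exact.isZero_of_both_zeros
    ((Ext.covariant_sequence_exact₃' _ hxreg'.smulShortComplex_shortExact) i (i + 1) rfl)
    (zero1.eq_zero_of_src _) (zero2.eq_zero_of_tgt _)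

end Local

/-! ### Depth bounds from elements killed by variables -/

section Polynomial

open RingTheory.Sequence Pointwise

universe u

variable {K : Type u} [Field K] {n : ℕ}

theorem ringKrullDim_quotient_span_X_le (Z : Finset (Fin n)) :
    ringKrullDim (MvPolynomial (Fin n) K ⧸
      Ideal.span (X '' (Z : Set (Fin n)) : Set (MvPolynomial (Fin n) K))) ≤
      ((n - Z.card : ℕ) : WithBot ℕ∞) := by
  set J := Ideal.span (X '' (Z : Set (Fin n)) : Set (MvPolynomial (Fin n) K))
  let φ : MvPolynomial {i // i ∉ Z} K →ₐ[K] MvPolynomial (Fin n) K ⧸ J :=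
    (Ideal.Quotient.mkₐ K J).comp (rename Subtype.val)
  have hφ : Function.Surjective φ := by
    rw [← AlgHom.range_eq_top, eq_top_iff]
    have hle : (⊤ : Subalgebra K (MvPolynomial (Fin n) K)) ≤
        φ.range.comap (Ideal.Quotient.mkₐ K J) := by
      rw [← adjoin_range_X, Algebra.adjoin_le_iff]
      rintro _ ⟨i, rfl⟩
      by_cases hi : i ∈ Z
      · have h0 : Ideal.Quotient.mkₐ K J (X i) = 0 :=
          Ideal.Quotient.eq_zero_iff_mem.2 (Ideal.subset_span ⟨i, hi, rfl⟩)
        change Ideal.Quotient.mkₐ K J (X i) ∈ φ.range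
        rw [h0]
        exact zero_mem _
      · exact ⟨X ⟨i, hi⟩, by simp [φ]⟩
    intro q _
    obtain ⟨p, rfl⟩ := Ideal.Quotient.mk_surjective q
    exact hle (x := p) trivial
  refine (ringKrullDim_le_of_surjective φ.toRingHom hφ).trans ?_
  rw [MvPolynomial.ringKrullDim_of_isNoetherianRing, ringKrullDim_eq_zero_of_field, zero_add]
  simp [Fintype.card_subtype_compl]

theorem mem_idealOfVars_iff {p : MvPolynomial (Fin n) K} :
    p ∈ idealOfVars (Fin n) K ↔ coeff 0 p = 0 := by
  have := mem_pow_idealOfVars_iff' (R := K) 1 p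
  rw [pow_one] at this
  simpa [Finsupp.degree_eq_zero_iff] using this

instance isPrime_idealOfVars : (idealOfVars (Fin n) K).IsPrime := by
  have : idealOfVars (Fin n) K = RingHom.ker (constantCoeff (R := K) (σ := Fin n)) := by
    ext p
    rw [mem_idealOfVars_iff, RingHom.mem_ker, constantCoeff_eq]
  rw [this]
  exact RingHom.ker_isPrime _

theorem X_mem_idealOfVars (i : Fin n) : (X i : MvPolynomial (Fin n) K) ∈ idealOfVars (Fin n) K :=
  Ideal.subset_span ⟨i, rfl⟩

variable {M : Type u} [AddCommGroup M] [Module (MvPolynomial (Fin n) K) M]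

/-- If the localization of `R` at a prime `p` has an ideal `P` containing the image of `J`, then
`dim R_p / P ≤ dim R / J`. -/
theorem ringKrullDim_localization_quotient_le {R : Type*} [CommRing R] (p : Ideal R) [p.IsPrime]
    {J : Ideal R} {P : Ideal (Localization.AtPrime p)}
    (h : J ≤ P.comap (algebraMap R (Localization.AtPrime p))) :
    ringKrullDim (Localization.AtPrime p ⧸ P) ≤ ringKrullDim (R ⧸ J) := by
  rw [ringKrullDim_quotient, ringKrullDim_quotient]
  let g : PrimeSpectrum.zeroLocus (P : Set (Localization.AtPrime p)) →
      PrimeSpectrum.zeroLocus (J : Set R) := fun q =>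
    ⟨PrimeSpectrum.comap (algebraMap R (Localization.AtPrime p)) q.1,
      fun _ ha => q.2 (h ha)⟩
  refine Order.krullDim_le_of_strictMono g (Monotone.strictMono_of_injective ?_ ?_)
  · intro q q' hqq
    exact Ideal.comap_mono (show q.1.asIdeal ≤ q'.1.asIdeal from hqq)
  · intro q q' hqq
    exact Subtype.ext (PrimeSpectrum.localization_comap_injective (Localization.AtPrime p)
      p.primeCompl (congrArg Subtype.val hqq))

/-- By Nakayama, `𝔪 M = M` would give an element congruent to 1 modulo `𝔪` that kills `m`. This
excludes the infinite branch of `depth`. -/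
theorem smul_top_ne_top_of_annihilator_le [Module.Finite (MvPolynomial (Fin n) K) M] (m : M)
    (hm : ∀ s : MvPolynomial (Fin n) K, s • m = 0 → s ∈ idealOfVars (Fin n) K) :
    (idealOfVars (Fin n) K • ⊤ : Submodule (MvPolynomial (Fin n) K) M) ≠ ⊤ := by
  intro h
  obtain ⟨r, hr, hr0⟩ := Submodule.exists_sub_one_mem_and_smul_eq_zero_of_fg_of_le_smul _ _
    (Module.Finite.fg_top (R := MvPolynomial (Fin n) K) (M := M)) h.ge
  have := (idealOfVars (Fin n) K).sub_mem (hm r (hr0 m trivial)) hr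
  rw [sub_sub_cancel, mem_idealOfVars_iff] at this
  simp at this

/-- An `M`-regular sequence in `𝔪` has length at most `n - |Z|` if some `m ∈ M`, nonzero locally at
`𝔪`, is annihilated by the variables in `Z`. -/
theorem length_le_of_isWeaklyRegular [Module.Finite (MvPolynomial (Fin n) K) M]
    {rs : List (MvPolynomial (Fin n) K)} (reg : IsWeaklyRegular M rs)
    (mem : ∀ f ∈ rs, f ∈ idealOfVars (Fin n) K) (m : M)
    (hm : ∀ s : MvPolynomial (Fin n) K, s • m = 0 → s ∈ idealOfVars (Fin n) K)
    (Z : Finset (Fin n)) (hZ : ∀ i ∈ Z, (X i : MvPolynomial (Fin n) K) • m = 0) :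
    rs.length ≤ n - Z.card := by
  set 𝔪 := idealOfVars (Fin n) K
  let ι := LocalizedModule.mkLinearMap 𝔪.primeCompl M
  have reg' := reg.of_isLocalizedModule (Localization.AtPrime 𝔪) 𝔪.primeCompl ι
  have hne : ι m ≠ 0 := by
    rw [Ne, IsLocalizedModule.eq_zero_iff 𝔪.primeCompl ι]
    rintro ⟨s, hs⟩
    exact s.2 (hm s hs)
  -- `P` contains the annihilator of the image of `m`, hence all variables in `Z`.
  obtain ⟨P, hP, hle⟩ :=
    exists_le_isAssociatedPrime_of_isNoetherianRing (Localization.AtPrime 𝔪) _ hne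
  have hlen := length_le_ringKrullDim_of_isAssociatedPrime _ reg' (by
    intro r hr
    obtain ⟨f, hf, rfl⟩ := List.mem_map.1 hr
    exact (IsLocalization.AtPrime.to_map_mem_maximal_iff _ 𝔪 f).2 (mem f hf)) hP
  have hdim := ringKrullDim_localization_quotient_le 𝔪 (P := P)
    (J := Ideal.span (X '' (Z : Set (Fin n)))) (by
      rw [Ideal.span_le]
      rintro _ ⟨i, hi, rfl⟩
      refine hle ?_
      rw [Submodule.mem_colon_singleton, Submodule.mem_bot, algebraMap_smul, ← map_smul, hZ i hi,
        map_zero])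
  have := (hlen.trans hdim).trans (ringKrullDim_quotient_span_X_le Z)
  rw [List.length_map] at this
  exact_mod_cast this

theorem depth_le [Module.Finite (MvPolynomial (Fin n) K) M] (m : M)
    (hm : ∀ s : MvPolynomial (Fin n) K, s • m = 0 → s ∈ idealOfVars (Fin n) K)
    (Z : Finset (Fin n)) (hZ : ∀ i ∈ Z, (X i : MvPolynomial (Fin n) K) • m = 0) :
    depth K n M ≤ ((n - Z.card : ℕ) : ℕ∞) := by
  rw [depth, if_neg (smul_top_ne_top_of_annihilator_le m hm)]
  exact iSup_le fun rs => iSup_le fun reg => iSup_le fun mem => Nat.cast_le.2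
    (length_le_of_isWeaklyRegular reg.toIsWeaklyRegular mem m hm Z hZ)

/-- The analogue of `depth_le` for an element of `M / xM`, where `x ∈ 𝔪` is `M`-regular. -/
theorem depth_le_of_quotSMulTop [Module.Finite (MvPolynomial (Fin n) K) M]
    {x : MvPolynomial (Fin n) K} (hx : x ∈ idealOfVars (Fin n) K) (hxreg : IsSMulRegular M x)
    (m : QuotSMulTop x M)
    (hm : ∀ s : MvPolynomial (Fin n) K, s • m = 0 → s ∈ idealOfVars (Fin n) K)
    (Z : Finset (Fin n)) (hZ : ∀ i ∈ Z, (X i : MvPolynomial (Fin n) K) • m = 0) :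
    depth K n M ≤ ((n - Z.card + 1 : ℕ) : ℕ∞) := by
  have htop : (idealOfVars (Fin n) K • ⊤ : Submodule (MvPolynomial (Fin n) K) M) ≠ ⊤ := by
    obtain ⟨y, rfl⟩ := Submodule.Quotient.mk_surjective _ m
    refine smul_top_ne_top_of_annihilator_le y fun s hs => hm s ?_
    rw [← Submodule.Quotient.mk_smul, hs, Submodule.Quotient.mk_zero]
  rw [depth, if_neg htop]
  refine iSup_le fun rs => iSup_le fun reg => iSup_le fun mem => Nat.cast_le.2 ?_
  rcases hk : rs.length with _ | k
  · exact Nat.zero_le _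
  · obtain ⟨rs', hlen, mem', reg'⟩ := exists_isRegular_quotSMulTop htop reg mem hk hx hxreg
    rw [← hlen]
    exact Nat.succ_le_succ (length_le_of_isWeaklyRegular reg'.toIsWeaklyRegular mem' m hm Z hZ)

end Polynomial

/-! ### Monomials just outside the ideal, and the cases by number of generators -/

section Depth

universe u

open Pointwise

variable {K : Type u} [Field K] {n : ℕ} {I : Ideal (MvPolynomial (Fin n) K)}

/-- The coefficient of $x^a$ in $s\,x^a$ is the constant term of $s$. -/
theorem IsMonomialIdeal.mem_idealOfVars_of_mul_mem (hI : IsMonomialIdeal I) {a : Fin n →₀ ℕ}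
    (ha : a ∉ exponents I) {s : MvPolynomial (Fin n) K} (hs : s * monomial a 1 ∈ I) :
    s ∈ idealOfVars (Fin n) K := by
  rw [mem_idealOfVars_iff]
  by_contra h
  refine ha (hI.mem_iff.1 hs a ?_)
  rw [mem_support_iff]
  have := coeff_mul_monomial 0 a 1 s
  rw [zero_add, mul_one] at this
  rwa [this]

theorem X_mul_monomial_one (i : Fin n) (a : Fin n →₀ ℕ) :
    (X i : MvPolynomial (Fin n) K) * monomial a 1 = monomial (a + Finsupp.single i 1) 1 := by
  rw [X, monomial_mul, one_mul, add_comm]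

theorem IsMonomialIdeal.depth_quotient_le (hI : IsMonomialIdeal I) {a : Fin n →₀ ℕ}
    (ha : a ∉ exponents I) (Z : Finset (Fin n))
    (hZ : ∀ i ∈ Z, a + Finsupp.single i 1 ∈ exponents I) :
    depth K n (MvPolynomial (Fin n) K ⧸ I) ≤ ((n - Z.card : ℕ) : ℕ∞) := by
  refine depth_le (Ideal.Quotient.mk I (monomial a 1)) (fun s hs => ?_) Z fun i hi => ?_
  · exact hI.mem_idealOfVars_of_mul_mem ha (Ideal.Quotient.eq_zero_iff_mem.1 hs)
  · change Ideal.Quotient.mk I (X i * monomial a 1) = 0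
    rw [Ideal.Quotient.eq_zero_iff_mem, X_mul_monomial_one]
    exact hZ i hi

/-- Fix $i\in Z$. The class of $x_ix^a$ in $I/x_iI$ is killed by every $x_j$ with $j\in Z$, since
$x_j(x_ix^a)=x_i(x_jx^a)$ and $x_jx^a\in I$; it is nonzero because $x^a\notin I$. -/
theorem IsMonomialIdeal.depth_ideal_le (hI : IsMonomialIdeal I) {a : Fin n →₀ ℕ}
    (ha : a ∉ exponents I) (Z : Finset (Fin n)) (hne : Z.Nonempty)
    (hZ : ∀ i ∈ Z, a + Finsupp.single i 1 ∈ exponents I) :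
    depth K n I ≤ ((n - Z.card + 1 : ℕ) : ℕ∞) := by
  obtain ⟨i, hi⟩ := hne
  have hcoe : ∀ j ∈ Z, (idealMonomial I (a + Finsupp.single j 1) : MvPolynomial (Fin n) K) =
      X j * monomial a 1 := fun j hj => by rw [coe_idealMonomial (hZ j hj), X_mul_monomial_one]
  have hreg : IsSMulRegular (MvPolynomial (Fin n) K) (X i : MvPolynomial (Fin n) K) :=
    IsSMulRegular.of_right_eq_zero_of_smul fun p hp => (mul_eq_zero.1 hp).resolve_left (X_ne_zero i)
  refine depth_le_of_quotSMulTop (X_mem_idealOfVars i) (hreg.submodule I _)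
    (Submodule.Quotient.mk (idealMonomial I (a + Finsupp.single i 1))) (fun s hs => ?_) Z
    fun j hj => ?_
  · rw [← Submodule.Quotient.mk_smul, Submodule.Quotient.mk_eq_zero] at hs
    obtain ⟨z, -, hz⟩ := hs
    have hz' : X i * (z : MvPolynomial (Fin n) K) = s * (idealMonomial I _ : MvPolynomial _ K) :=
      congrArg Subtype.val hz
    rw [hcoe i hi, mul_left_comm] at hz'
    exact hI.mem_idealOfVars_of_mul_mem ha (mul_left_cancel₀ (X_ne_zero i) hz' ▸ z.2)
  · rw [← Submodule.Quotient.mk_smul, Submodule.Quotient.mk_eq_zero]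
    refine ⟨idealMonomial I (a + Finsupp.single j 1), trivial, Subtype.ext ?_⟩
    change X i * (idealMonomial I _ : MvPolynomial _ K) = X j * (idealMonomial I _ : MvPolynomial _ K)
    rw [hcoe i hi, hcoe j hj, mul_left_comm]

theorem depth_ideal_le_of_mem {a : Fin n →₀ ℕ} (ha : a ∈ exponents I) :
    depth K n I ≤ (n : ℕ∞) := by
  refine (depth_le (idealMonomial I a) (fun s hs => ?_) ∅ (by simp)).trans (by simp)
  have h : s * (idealMonomial I a : MvPolynomial (Fin n) K) = 0 := congrArg Subtype.val hs
  rw [coe_idealMonomial ha] at h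
  rw [(mul_eq_zero.1 h).resolve_right (by simp)]
  exact zero_mem _

theorem exists_minimalGenerators_le {a : Fin n →₀ ℕ} (ha : a ∈ exponents I) :
    ∃ g ∈ minimalGenerators I, g ≤ a := by
  obtain ⟨g, hga, hg⟩ := exists_minimal_le_of_wellFoundedLT (· ∈ exponents I) a ha
  exact ⟨g, hg, hga⟩

theorem mem_exponents_of_mem_minimalGenerators {g : Fin n →₀ ℕ} (hg : g ∈ minimalGenerators I) :
    g ∈ exponents I :=
  Minimal.prop (P := (· ∈ exponents I)) hg

theorem mem_exponents_iff {a : Fin n →₀ ℕ} :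
    a ∈ exponents I ↔ ∃ g ∈ minimalGenerators I, g ≤ a :=
  ⟨exists_minimalGenerators_le, fun ⟨_, hg, hga⟩ =>
    isUpperSet_exponents hga (mem_exponents_of_mem_minimalGenerators hg)⟩

/-- The witness is `m` lowered by one in each coordinate of `Z`. By `h2` no generator divides it; by
`h1` restoring coordinate `i` lets some element of `exponents I` lie below it. -/
theorem exists_notMem_exponents (m : Fin n →₀ ℕ) (Z : Finset (Fin n)) (hpos : ∀ i ∈ Z, 0 < m i)
    (h1 : ∀ i ∈ Z, ∃ g ∈ exponents I, g ≤ m ∧ ∀ j ∈ Z, j ≠ i → g j < m j)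
    (h2 : ∀ g ∈ minimalGenerators I, g ≤ m → ∃ i ∈ Z, m i ≤ g i) :
    ∃ a ∉ exponents I, ∀ i ∈ Z, a + Finsupp.single i 1 ∈ exponents I := by
  classical
  let a : Fin n →₀ ℕ := Finsupp.equivFunOnFinite.symm fun k => if k ∈ Z then m k - 1 else m k
  have ha : ∀ k, a k = if k ∈ Z then m k - 1 else m k := fun _ => rfl
  have ham : a ≤ m := fun k => by rw [ha]; split_ifs <;> omega
  refine ⟨a, fun hmem => ?_, fun i hi => ?_⟩
  · obtain ⟨g, hg, hga⟩ := exists_minimalGenerators_le hmem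
    obtain ⟨i, hi, hmi⟩ := h2 g hg (hga.trans ham)
    have h3 := hga i
    rw [ha, if_pos hi] at h3
    have := hpos i hi
    omega
  · obtain ⟨g, hg, hgm, hlt⟩ := h1 i hi
    refine isUpperSet_exponents (fun k => ?_) hg
    have hk := hgm k
    rw [Finsupp.add_apply, ha, Finsupp.single_apply]
    by_cases hkZ : k ∈ Z
    · by_cases hik : i = k
      · simp [hik, hkZ]; subst hik; omega
      · have := hlt k hkZ (Ne.symm hik)
        simp [hik, hkZ]; omega
    · rw [if_neg hkZ]; omega

theorem exists_lt_of_mem_minimalGenerators {u v : Fin n →₀ ℕ} (hu : u ∈ minimalGenerators I)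
    (hv : v ∈ minimalGenerators I) (huv : u ≠ v) : ∃ i, v i < u i := by
  by_contra! h
  exact huv (Minimal.eq_of_le (P := (· ∈ exponents I)) hv
    (mem_exponents_of_mem_minimalGenerators hu) h)

theorem exists_pair_of_ne {u v : Fin n →₀ ℕ} (hu : u ∈ minimalGenerators I)
    (hv : v ∈ minimalGenerators I) (huv : u ≠ v) :
    ∃ a ∉ exponents I, ∃ Z : Finset (Fin n), Z.card = 2 ∧
      ∀ i ∈ Z, a + Finsupp.single i 1 ∈ exponents I := by
  classical
  let P : Set ((Fin n →₀ ℕ) × (Fin n →₀ ℕ)) :=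
    {p | p.1 ∈ minimalGenerators I ∧ p.2 ∈ minimalGenerators I ∧ p.1 ≠ p.2}
  -- The pair is replaced by one with minimal lcm: a generator `g ≤ p ⊔ q` strictly below it at both
  -- `i` and `j` would make `p ⊔ g` smaller than `p ⊔ q` at `j`.
  obtain ⟨⟨p, q⟩, ⟨hp, hq, hpq⟩, hmin⟩ := exists_minimalFor_of_wellFoundedLT (· ∈ P)
    (fun p => p.1 ⊔ p.2) ⟨(u, v), hu, hv, huv⟩
  dsimp only at hp hq hpq
  obtain ⟨i, hi⟩ := exists_lt_of_mem_minimalGenerators hp hq hpq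
  obtain ⟨j, hj⟩ := exists_lt_of_mem_minimalGenerators hq hp hpq.symm
  have hij : i ≠ j := by rintro rfl; omega
  have hex := exists_notMem_exponents (I := I) (p ⊔ q) {i, j} ?_ ?_ ?_
  · obtain ⟨a, ha, haZ⟩ := hex
    exact ⟨a, ha, {i, j}, Finset.card_pair hij, haZ⟩
  · simp only [Finset.mem_insert, Finset.mem_singleton, forall_eq_or_imp, forall_eq,
      Finsupp.sup_apply]
    omega
  · simp only [Finset.mem_insert, Finset.mem_singleton, forall_eq_or_imp, forall_eq,
      Finsupp.sup_apply]
    exact ⟨⟨p, mem_exponents_of_mem_minimalGenerators hp, le_sup_left, by simp, fun _ => by omega⟩,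
      ⟨q, mem_exponents_of_mem_minimalGenerators hq, le_sup_right, fun _ => by omega, by simp⟩⟩
  · intro g hg hgm
    by_contra! hcon
    have hgi := hcon i (by simp)
    have hgj := hcon j (by simp)
    have hpg : p ≠ g := by
      rintro rfl
      simp only [Finsupp.sup_apply] at hgi
      omega
    have := hmin (j := (p, g)) ⟨hp, hg, hpg⟩ (sup_le le_sup_left hgm) j
    simp only [Finsupp.sup_apply] at this hgj
    omega

/-- Each generator strictly exceeds both others in some coordinate. These three coordinates are
distinct and form `Z`, with the lcm of all three generators as `m`. -/
theorem exists_triple {u v w : Fin n →₀ ℕ} (hG : minimalGenerators I = {u, v, w})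
    (hu : ¬ u ≤ v ⊔ w) (hv : ¬ v ≤ w ⊔ u) (hw : ¬ w ≤ u ⊔ v) :
    ∃ a ∉ exponents I, ∃ Z : Finset (Fin n), Z.card = 3 ∧
      ∀ i ∈ Z, a + Finsupp.single i 1 ∈ exponents I := by
  classical
  have key : ∀ x y z : Fin n →₀ ℕ, ¬ x ≤ y ⊔ z → ∃ i, y i < x i ∧ z i < x i := by
    intro x y z h
    by_contra! hcon
    refine h fun i => ?_
    have := hcon i
    rw [Finsupp.sup_apply]
    by_cases hy : y i < x i
    · exact (this hy).trans le_sup_right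
    · exact (not_lt.1 hy).trans le_sup_left
  obtain ⟨i, hi1, hi2⟩ := key _ _ _ hu
  obtain ⟨j, hj1, hj2⟩ := key _ _ _ hv
  obtain ⟨k, hk1, hk2⟩ := key _ _ _ hw
  have hij : i ≠ j := by rintro rfl; omega
  have hik : i ≠ k := by rintro rfl; omega
  have hjk : j ≠ k := by rintro rfl; omega
  have hmem : ∀ g ∈ ({u, v, w} : Set (Fin n →₀ ℕ)), g ∈ exponents I :=
    fun g hg => mem_exponents_of_mem_minimalGenerators (hG ▸ hg)
  have hex := exists_notMem_exponents (I := I) (u ⊔ v ⊔ w) {i, j, k} ?_ ?_ ?_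
  · obtain ⟨a, ha, haZ⟩ := hex
    exact ⟨a, ha, {i, j, k}, Finset.card_eq_three.2 ⟨i, j, k, hij, hik, hjk, rfl⟩, haZ⟩
  · simp only [Finset.mem_insert, Finset.mem_singleton, forall_eq_or_imp, forall_eq,
      Finsupp.sup_apply]
    omega
  · simp only [Finset.mem_insert, Finset.mem_singleton, forall_eq_or_imp, forall_eq,
      Finsupp.sup_apply]
    refine ⟨⟨u, hmem u (by simp), le_sup_of_le_left le_sup_left, ?_⟩,
      ⟨v, hmem v (by simp), le_sup_of_le_left le_sup_right, ?_⟩,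
      ⟨w, hmem w (by simp), le_sup_right, ?_⟩⟩ <;> omega
  · rw [hG]
    simp only [Set.mem_insert_iff, Set.mem_singleton_iff, forall_eq_or_imp, forall_eq,
      Finset.mem_insert, Finset.mem_singleton, Finsupp.sup_apply]
    exact ⟨fun _ => ⟨i, by simp, by omega⟩, fun _ => ⟨j, by simp, by omega⟩,
      fun _ => ⟨k, by simp, by omega⟩⟩

/-- Once the multiples of $x^w$ are removed, no common multiple of $x^u$ and $x^v$ remains, so
removing both of these up-sets costs a single dimension. -/
theorem CylinderPartition.compl_of_le_sup {u v w : Fin n →₀ ℕ} (h : w ≤ u ⊔ v) :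
    CylinderPartition (n - 2) (Set.Ici u ∪ Set.Ici v ∪ Set.Ici w)ᶜ := by
  have hP := (CylinderPartition.univ.sdiff_Ici w).sdiff_Ici_sdiff_Ici u v ?_
  · rw [Nat.sub_sub] at hP
    convert hP using 1
    ext b
    simp only [Set.mem_compl_iff, Set.mem_union, Set.mem_sdiff, Set.mem_univ, true_and]
    tauto
  · ext b
    simp only [Set.mem_inter_iff, Set.mem_sdiff, Set.mem_univ, true_and, Set.mem_Ici,
      Set.mem_empty_iff_false, iff_false, not_and]
    exact fun hw huv => hw (h.trans huv)

variable {u v w : Fin n →₀ ℕ}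

theorem IsMonomialIdeal.depth_le_sdepth_of_minimalGenerators_eq_empty (hI : IsMonomialIdeal I)
    (hG : minimalGenerators I = ∅) :
    depth K n I ≤ sdepth (idealGrading I) ∧
      depth K n (MvPolynomial (Fin n) K ⧸ I) ≤ sdepth (quotientGrading I) := by
  have hE : exponents I = ∅ := by ext a; simp [mem_exponents_iff, hG]
  refine ⟨(hI.sdepth_ideal_eq_top hE).symm ▸ le_top, ?_⟩
  refine (hI.depth_quotient_le (a := 0) (by simp [hE]) ∅ (by simp)).trans ?_
  exact hI.le_sdepth_quotient (by simpa [hE] using CylinderPartition.univ)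

theorem IsMonomialIdeal.depth_le_sdepth_of_minimalGenerators_eq_singleton (hI : IsMonomialIdeal I)
    (hG : minimalGenerators I = {u}) :
    depth K n I ≤ sdepth (idealGrading I) ∧
      depth K n (MvPolynomial (Fin n) K ⧸ I) ≤ sdepth (quotientGrading I) := by
  have hE : exponents I = Set.Ici u := by ext a; simp [mem_exponents_iff, hG]
  have hu : u ∈ exponents I := hE ▸ Set.mem_Ici.2 le_rfl
  refine ⟨(depth_ideal_le_of_mem hu).trans
    (hI.le_sdepth_ideal (hE ▸ CylinderPartition.Ici u)), ?_⟩
  by_cases hu0 : ∃ i, 0 < u i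
  · obtain ⟨i, hi⟩ := hu0
    obtain ⟨a, ha, haZ⟩ := exists_notMem_exponents (I := I) u {i} (by simpa using hi)
      (by simpa using ⟨u, hu, le_rfl⟩) (by simp [hG])
    refine (hI.depth_quotient_le ha _ haZ).trans (hI.le_sdepth_quotient ?_)
    rw [hE, Set.compl_eq_univ_sdiff, Finset.card_singleton]
    exact CylinderPartition.univ.sdiff_Ici u
  -- Here $I=S$, so the quotient is zero and its sdepth infinite.
  · have : u = 0 := by
      ext i
      simpa using not_exists.1 hu0 i
    rw [hI.sdepth_quotient_eq_top (by rw [hE, this]; ext b; simp)]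
    exact le_top

theorem IsMonomialIdeal.depth_ideal_le_of_ne (hI : IsMonomialIdeal I)
    (hu : u ∈ minimalGenerators I) (hv : v ∈ minimalGenerators I) (huv : u ≠ v) :
    depth K n I ≤ ((n - 1 : ℕ) : ℕ∞) := by
  obtain ⟨a, ha, Z, hcard, haZ⟩ := exists_pair_of_ne hu hv huv
  -- Needed for truncated subtraction: `n - 2 + 1 = n - 1` requires `2 ≤ n`.
  have hn : Z.card ≤ n := by simpa using Z.card_le_univ
  have h := hI.depth_ideal_le ha Z (Finset.card_pos.1 (by omega)) haZ
  rwa [show n - Z.card + 1 = n - 1 by omega] at h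

theorem IsMonomialIdeal.depth_quotient_le_of_ne (hI : IsMonomialIdeal I)
    (hu : u ∈ minimalGenerators I) (hv : v ∈ minimalGenerators I) (huv : u ≠ v) :
    depth K n (MvPolynomial (Fin n) K ⧸ I) ≤ ((n - 2 : ℕ) : ℕ∞) := by
  obtain ⟨a, ha, Z, hcard, haZ⟩ := exists_pair_of_ne hu hv huv
  exact hcard ▸ hI.depth_quotient_le ha Z haZ

theorem IsMonomialIdeal.depth_le_sdepth_of_minimalGenerators_eq_pair (hI : IsMonomialIdeal I)
    (huv : u ≠ v) (hG : minimalGenerators I = {u, v}) :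
    depth K n I ≤ sdepth (idealGrading I) ∧
      depth K n (MvPolynomial (Fin n) K ⧸ I) ≤ sdepth (quotientGrading I) := by
  have hE : exponents I = Set.Ici u ∪ Set.Ici v := by ext a; simp [mem_exponents_iff, hG]
  have hu : u ∈ minimalGenerators I := by simp [hG]
  have hv : v ∈ minimalGenerators I := by simp [hG]
  refine ⟨(hI.depth_ideal_le_of_ne hu hv huv).trans (hI.le_sdepth_ideal
    (hE ▸ CylinderPartition.Ici_union_Ici u v)), (hI.depth_quotient_le_of_ne hu hv huv).trans
    (hI.le_sdepth_quotient ?_)⟩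
  rw [hE, Set.compl_eq_univ_sdiff, ← Set.sdiff_sdiff]
  exact (CylinderPartition.univ.sdiff_Ici u).sdiff_Ici v

theorem IsMonomialIdeal.depth_le_sdepth_of_minimalGenerators_eq_triple (hI : IsMonomialIdeal I)
    (huv : u ≠ v) (hG : minimalGenerators I = {u, v, w}) :
    depth K n I ≤ sdepth (idealGrading I) ∧
      depth K n (MvPolynomial (Fin n) K ⧸ I) ≤ sdepth (quotientGrading I) := by
  have hE : exponents I = Set.Ici u ∪ Set.Ici v ∪ Set.Ici w := by
    ext a; simp [mem_exponents_iff, hG, or_assoc]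
  have hu : u ∈ minimalGenerators I := by simp [hG]
  have hv : v ∈ minimalGenerators I := by simp [hG]
  refine ⟨(hI.depth_ideal_le_of_ne hu hv huv).trans (hI.le_sdepth_ideal
    (hE ▸ CylinderPartition.Ici_union_Ici_union_Ici u v w)), ?_⟩
  by_cases hsup : u ≤ v ⊔ w ∨ v ≤ w ⊔ u ∨ w ≤ u ⊔ v
  · refine (hI.depth_quotient_le_of_ne hu hv huv).trans (hI.le_sdepth_quotient ?_)
    rw [hE]
    rcases hsup with h | h | h
    · convert CylinderPartition.compl_of_le_sup h using 2
      rw [Set.union_comm _ (Set.Ici u), Set.union_assoc]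
    · convert CylinderPartition.compl_of_le_sup h using 2
      rw [Set.union_comm _ (Set.Ici w), Set.union_assoc]
    · exact CylinderPartition.compl_of_le_sup h
  · push Not at hsup
    obtain ⟨a, ha, Z, hcard, haZ⟩ := exists_triple hG hsup.1 hsup.2.1 hsup.2.2
    refine (hI.depth_quotient_le ha Z haZ).trans (hI.le_sdepth_quotient ?_)
    rw [hE, Set.compl_eq_univ_sdiff, ← Set.sdiff_sdiff, ← Set.sdiff_sdiff, hcard]
    exact ((CylinderPartition.univ.sdiff_Ici u).sdiff_Ici v).sdiff_Ici w

end Depth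

end Stanley

theorem theorem2p6 {K : Type*} [Field K] (n : ℕ) (I : Ideal (MvPolynomial (Fin n) K))
    (hI : Stanley.IsMonomialIdeal I) (hg : Stanley.numGenerators I ≤ 3) :
    Stanley.depth K n I ≤ Stanley.sdepth (Stanley.idealGrading I) ∧
    Stanley.depth K n (MvPolynomial (Fin n) K ⧸ I) ≤
      Stanley.sdepth (Stanley.quotientGrading I) := by
  rw [Stanley.numGenerators] at hg
  obtain ⟨k, hk⟩ := ENat.ne_top_iff_exists.1 (ne_top_of_le_ne_top (ENat.natCast_ne_top 3) hg)
  rw [← hk] at hg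
  have hk3 : k ≤ 3 := by exact_mod_cast hg
  interval_cases k
  · exact hI.depth_le_sdepth_of_minimalGenerators_eq_empty (Set.encard_eq_zero.1 hk.symm)
  · obtain ⟨u, hu⟩ := Set.encard_eq_one.1 hk.symm
    exact hI.depth_le_sdepth_of_minimalGenerators_eq_singleton hu
  · obtain ⟨u, v, huv, hG⟩ := Set.encard_eq_two.1 hk.symm
    exact hI.depth_le_sdepth_of_minimalGenerators_eq_pair huv hG
  · obtain ⟨u, v, w, huv, -, -, hG⟩ := Set.encard_eq_three.1 hk.symm
    exact hI.depth_le_sdepth_of_minimalGenerators_eq_triple huv hG
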